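/- Let $\mathbb{H}$ be the algebra of quaternions with Euclidean norm $|\cdot|$. For $p,q\in\mathbb{H}$ put $\triangle_q(p):=p^2-2\,\mathrm{Re}(q)\,p+|q|^2$ and let $\mathrm{u}(p,q):=\sqrt{|\triangle_q(p)|}$ be the Cassini pseudo-metric on $\mathbb{H}$. The Cassini ball of centre $q_0\in\mathbb{H}$ and radius $R>0$ is $\mathrm{U}(q_0,R):=\{p\in\mathbb{H}:\mathrm{u}(p,q_0)<R\}$, and the Cassini topology is the topology induced by $\mathrm{u}$. Let $X\neq\{0\}$ be a Banach two-sided $\mathbb{H}$-module, that is, an abelian group with a left and a right $\mathbb{H}$-module structure such that $p(xq)=(px)q$ for $p,q\in\mathbb{H}$, $x\in X$ and $rx=xr$ for $r\in\mathbb{R}$, equipped with a complete norm satisfying $\|qx\|=\|xq\|=|q|\,\|x\|$. Let $\mathcal{L}^r(X)$ be the set of right linear maps $B:X\to X$ with $\|B\|:=\sup\{\|Bx\|:\|x\|\le1\}<\infty$, endowed with this norm; for a right linear $B:X\to X$ and $q\in\mathbb{H}$, $Bq$ denotes the operator $x\mapsto B(qx)$. Let $A:D(A)\to X$ be a closed right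 linear operator defined on a right $\mathbb{H}$-submodule $D(A)$ of $X$ (closed means that its graph is closed in $X\times X$), and let $D(A^2):=\{x\in D(A):Ax\in D(A)\}$. For $q\in\mathbb{H}$ let $\Delta_q(A):=A^2-2\,\mathrm{Re}(q)\,A+|q|^2\,\mathrm{Id}:D(A^2)\to X$, and let $\rho_S(A)$ be the set of all $q\in\mathbb{H}$ such that $\Delta_q(A)$ is bijective and $\Delta_q(A)^{-1}\in\mathcal{L}^r(X)$. For $q\in\rho_S(A)$ put $$Q_q(A):=\Delta_q(A)^{-1},\qquad S_q^{-1}(A):=Q_q(A)\,\overline{q}-A\,Q_q(A).$$ Assume that $\rho_S(A)\cap\mathbb{R}\neq\emptyset$. Let $q_0\in\rho_S(A)$ and $R:=\|Q_{q_0}(A)\|^{-1/2}$, and for $k\in\mathbb{N}=\{0,1,2,\dots\}$ and $q\in\mathbb{H}$ define $$B_{2k}:=Q_{q_0}(A)^k,\quad B_{2k+1}:=Q_{q_0}(A)^k\,S_{q_0}^{-1}(A),\quad P_{q_0,2k}(q):=\triangle_{q_0}(q)^k,\quad P_{q_0,2k+1}(q):=(q-q_0)\,\triangle_{q_0}(q)^k.$$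 Then $R>0$, $B_n\in\mathcal{L}^r(X)$ for every $n\in\mathbb{N}$, and: (i) $\mathrm{U}(q_0,R)\subseteq\rho_S(A)$. (ii) $\rho_S(A)$ is open in the Cassini topology of $\mathbb{H}$, hence also in the Euclidean topology of $\mathbb{H}$. (iii) For every $q\in\mathrm{U}(q_0,R)$, the series $\sum_{n=0}^{\infty}(-1)^n B_{n+1}P_{q_0,n}(q)$ converges in $\mathcal{L}^r(X)$ and its sum is $S_q^{-1}(A)$: $$S_q^{-1}(A)=\sum_{n=0}^{\infty}(-1)^n B_{n+1}P_{q_0,n}(q).$$ -/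

import Mathlib

open scoped Quaternion ENNReal Topology
open MulOpposite Filter

noncomputable section

/-- Banach two-sided `ℍ`-modules.  The left action is the `ℍ`-module structure, the right action
`x q` is `op q • x` for the `ℍᵐᵒᵖ`-module structure; the mixed associativity `p (x q) = (p x) q`
is `SMulCommClass`. -/
class BanachTwoSidedModule (X : Type*) [NormedAddCommGroup X] [Module ℍ X] [Module ℍᵐᵒᵖ X] : Prop
    extends SMulCommClass ℍ ℍᵐᵒᵖ X, CompleteSpace X where
  real_smul : ∀ (r : ℝ) (x : X), (r : ℍ) • x = op (r : ℍ) • x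
  norm_left_smul : ∀ (q : ℍ) (x : X), ‖q • x‖ = ‖q‖ * ‖x‖
  norm_right_smul : ∀ (q : ℍ) (x : X), ‖op q • x‖ = ‖q‖ * ‖x‖

namespace SRes

/-! ### The Cassini pseudo-metric on the quaternions -/

/-- `△_q(p) = p² - 2 Re(q) p + |q|²`. -/
def tri (q p : ℍ) : ℍ := p ^ 2 - ((2 * q.re : ℝ) : ℍ) * p + ((‖q‖ ^ 2 : ℝ) : ℍ)

/-- The Cassini pseudo-metric `u(p, q) = √|△_q(p)|`. -/
def cassiniDist (p q : ℍ) : ℝ := √‖tri q p‖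

/-- The Cassini ball `U(q₀, R)`. -/
def cassiniBall (q₀ : ℍ) (R : ℝ) : Set ℍ := {p | cassiniDist p q₀ < R}

/-- The point of the closed upper half plane on the sphere of `q`. -/
def toUpper (q : ℍ) : ℂ := ⟨q.re, ‖q.im‖⟩

lemma norm_im_sq (q : ℍ) : ‖q.im‖ ^ 2 = q.imI ^ 2 + q.imJ ^ 2 + q.imK ^ 2 := by
  rw [sq, ← Quaternion.normSq_eq_norm_mul_self, Quaternion.normSq_def']
  simp

lemma norm_tri (q p : ℍ) :
    ‖tri q p‖ = ‖toUpper p - toUpper q‖ * ‖toUpper p - star (toUpper q)‖ := by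
  have hq : ‖q‖ ^ 2 = q.re ^ 2 + ‖q.im‖ ^ 2 := by
    rw [norm_im_sq, sq, ← Quaternion.normSq_eq_norm_mul_self, Quaternion.normSq_def']
    ring
  have hp := norm_im_sq p
  refine (sq_eq_sq₀ (norm_nonneg _) (by positivity)).1 ?_
  rw [mul_pow, ← Complex.normSq_eq_norm_sq, ← Complex.normSq_eq_norm_sq, sq ‖tri q p‖,
    ← Quaternion.normSq_eq_norm_mul_self, Quaternion.normSq_def', Complex.normSq_apply,
    Complex.normSq_apply, tri, hq]
  simp only [toUpper, sq p, Quaternion.re_add, Quaternion.re_sub, Quaternion.re_mul,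
    Quaternion.imI_add, Quaternion.imI_sub, Quaternion.imI_mul, Quaternion.imJ_add,
    Quaternion.imJ_sub, Quaternion.imJ_mul, Quaternion.imK_add, Quaternion.imK_sub,
    Quaternion.imK_mul, Quaternion.re_coe, Quaternion.imI_coe, Quaternion.imJ_coe,
    Quaternion.imK_coe, Complex.sub_re, Complex.sub_im, Complex.star_def, Complex.conj_re,
    Complex.conj_im]
  generalize ‖p.im‖ = b at *
  generalize ‖q.im‖ = d at *
  linear_combination (2 * (p.re ^ 2 - 2 * q.re * p.re + q.re ^ 2 + d ^ 2)
    - (p.imI ^ 2 + p.imJ ^ 2 + p.imK ^ 2) - b ^ 2 - 4 * (p.re - q.re) ^ 2) * hp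

lemma sqrt_triangle {a b A B z w : ℝ} (ha : 0 ≤ a) (hb : 0 ≤ b) (haA : a ≤ A) (hbB : b ≤ B)
    (hz : 0 ≤ z) (hw : 0 ≤ w) (hzab : z ≤ a + b) (h1 : w ≤ a + B) (h2 : w ≤ A + b) :
    √(z * w) ≤ √(a * A) + √(b * B) := by
  have hA := ha.trans haA
  have hB := hb.trans hbB
  refine Real.sqrt_le_iff.2 ⟨by positivity, ?_⟩
  have e : (√(a * A) + √(b * B)) ^ 2 = a * A + b * B + 2 * √(a * A * (b * B)) := by
    rw [add_sq, Real.sq_sqrt (by positivity), Real.sq_sqrt (by positivity),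
      Real.sqrt_mul (by positivity : 0 ≤ a * A)]
    ring
  rw [e]
  rcases le_total (A + b) (a + B) with h | h
  · have key : a * b ≤ √(a * A * (b * B)) := by
      refine Real.le_sqrt_of_sq_le ?_
      calc (a * b) ^ 2 = (a * a) * (b * b) := by ring
        _ ≤ a * A * (b * B) := by gcongr
    have h3 : z * w ≤ (a + b) * (A + b) := by gcongr
    nlinarith [mul_le_mul_of_nonneg_left h hb]
  · have key : a * b ≤ √(a * A * (b * B)) := by
      refine Real.le_sqrt_of_sq_le ?_
      calc (a * b) ^ 2 = (a * a) * (b * b) := by ring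
        _ ≤ a * A * (b * B) := by gcongr
    have h3 : z * w ≤ (a + b) * (a + B) := by gcongr
    nlinarith [mul_le_mul_of_nonneg_left h ha]

lemma cassiniDist_self (q : ℍ) : cassiniDist q q = 0 := by
  simp [cassiniDist, norm_tri]

lemma cassiniDist_comm (p q : ℍ) : cassiniDist p q = cassiniDist q p := by
  rw [cassiniDist, cassiniDist, norm_tri, norm_tri, norm_sub_rev (toUpper p) (toUpper q),
    ← norm_star (toUpper p - star (toUpper q)), star_sub, star_star, norm_sub_rev (star _)]

lemma norm_sub_le_norm_sub_star (p q : ℍ) :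
    ‖toUpper p - toUpper q‖ ≤ ‖toUpper p - star (toUpper q)‖ := by
  refine (sq_le_sq₀ (norm_nonneg _) (norm_nonneg _)).1 ?_
  rw [← Complex.normSq_eq_norm_sq, ← Complex.normSq_eq_norm_sq, Complex.normSq_apply,
    Complex.normSq_apply]
  simp only [toUpper, Complex.sub_re, Complex.sub_im, Complex.star_def, Complex.conj_re,
    Complex.conj_im]
  nlinarith [mul_nonneg (norm_nonneg p.im) (norm_nonneg q.im)]

lemma cassiniDist_triangle (p q r : ℍ) :
    cassiniDist p r ≤ cassiniDist p q + cassiniDist q r := by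
  simp only [cassiniDist, norm_tri]
  refine sqrt_triangle (norm_nonneg _) (norm_nonneg _) (norm_sub_le_norm_sub_star _ _)
    (norm_sub_le_norm_sub_star _ _) (norm_nonneg _) (norm_nonneg _) ?_ ?_ ?_
  · exact norm_sub_le_norm_sub_add_norm_sub _ _ _
  · exact norm_sub_le_norm_sub_add_norm_sub _ _ _
  · refine (norm_sub_le_norm_sub_add_norm_sub _ (star (toUpper q)) _).trans_eq ?_
    rw [← star_sub, norm_star]

/-- The pseudo-metric space `(ℍ, u)`; not an instance, since `ℍ` carries the Euclidean metric. -/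
abbrev cassiniPseudoMetric : PseudoMetricSpace ℍ where
  dist := cassiniDist
  dist_self := cassiniDist_self
  dist_comm := cassiniDist_comm
  dist_triangle := cassiniDist_triangle

/-- The Cassini topology of `ℍ`. -/
abbrev cassiniTopology : TopologicalSpace ℍ :=
  cassiniPseudoMetric.toUniformSpace.toTopologicalSpace

/-! ### Right linear operators -/

section Operators

variable {X : Type*} [NormedAddCommGroup X] [Module ℍᵐᵒᵖ X]

/-- The operator norm `sup {‖B x‖ : ‖x‖ ≤ 1}`, possibly infinite. -/
def opNorm (B : Module.End ℍᵐᵒᵖ X) : ℝ≥0∞ := ⨆ (x : X) (_ : ‖x‖ ≤ 1), ENNReal.ofReal ‖B x‖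

/-- `L^r(X)`, the bounded right linear operators defined on all of `X`. -/
def boundedOps (X : Type*) [NormedAddCommGroup X] [Module ℍᵐᵒᵖ X] :
    Set (Module.End ℍᵐᵒᵖ X) := {B | opNorm B < ∞}

/-- The series `∑ f n` converges in `L^r(X)` with respect to the operator norm, with sum `S`. -/
def SeriesConvergesTo (f : ℕ → Module.End ℍᵐᵒᵖ X) (S : Module.End ℍᵐᵒᵖ X) : Prop :=
  (∀ n, f n ∈ boundedOps X) ∧ S ∈ boundedOps X ∧
    Tendsto (fun N => opNorm (∑ n ∈ Finset.range N, f n - S)) atTop (𝓝 0)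

/-- `A` is closed: its graph is closed in `X × X`. -/
def IsClosedOp (A : X →ₗ.[ℍᵐᵒᵖ] X) : Prop := IsClosed (A.graph : Set (X × X))

/-- `D(A²) = {x ∈ D(A) : A x ∈ D(A)}`. -/
def sqDomain (A : X →ₗ.[ℍᵐᵒᵖ] X) : Submodule ℍᵐᵒᵖ X :=
  (A.domain.comap A.toFun).map A.domain.subtype

/-- The inclusion of `D(A²)` in `D(A)`. -/
def sqIncl (A : X →ₗ.[ℍᵐᵒᵖ] X) : sqDomain A →ₗ[ℍᵐᵒᵖ] A.domain :=
  Submodule.inclusion (Submodule.map_subtype_le _ _)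

lemma map_sqIncl_mem (A : X →ₗ.[ℍᵐᵒᵖ] X) (x : sqDomain A) : A (sqIncl A x) ∈ A.domain := by
  obtain ⟨_, y, hy, rfl⟩ := x
  exact hy

/-- `A²` as a right linear map on `D(A²)`. -/
def sqOp (A : X →ₗ.[ℍᵐᵒᵖ] X) : sqDomain A →ₗ[ℍᵐᵒᵖ] X :=
  A.toFun ∘ₗ (A.toFun ∘ₗ sqIncl A).codRestrict A.domain (map_sqIncl_mem A)

variable [Module ℍ X] [SMulCommClass ℍ ℍᵐᵒᵖ X]

/-- Left multiplication `x ↦ q x`, a right linear operator. -/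
def leftMul (q : ℍ) : Module.End ℍᵐᵒᵖ X := DistribSMul.toLinearMap ℍᵐᵒᵖ X q

/-- The operator `B q`, that is `x ↦ B (q x)`. -/
def opMul (B : Module.End ℍᵐᵒᵖ X) (q : ℍ) : Module.End ℍᵐᵒᵖ X := B * leftMul q

/-- `Δ_q(A) = A² - 2 Re(q) A + |q|² Id : D(A²) → X`. -/
def Delta (A : X →ₗ.[ℍᵐᵒᵖ] X) (q : ℍ) : sqDomain A →ₗ[ℍᵐᵒᵖ] X :=
  sqOp A - leftMul ((2 * q.re : ℝ) : ℍ) ∘ₗ A.toFun ∘ₗ sqIncl A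
    + leftMul ((‖q‖ ^ 2 : ℝ) : ℍ) ∘ₗ (sqDomain A).subtype

/-- `Δ_q(A)⁻¹ : X → D(A²)`, when `Δ_q(A)` is bijective. -/
def DeltaInv (A : X →ₗ.[ℍᵐᵒᵖ] X) (q : ℍ) (h : Function.Bijective (Delta A q)) :
    X →ₗ[ℍᵐᵒᵖ] sqDomain A :=
  ((LinearEquiv.ofBijective (Delta A q) h).symm : X →ₗ[ℍᵐᵒᵖ] sqDomain A)

/-- `Q_q(A) = Δ_q(A)⁻¹` as an operator `X → X`. -/
def Q (A : X →ₗ.[ℍᵐᵒᵖ] X) (q : ℍ) (h : Function.Bijective (Delta A q)) : Module.End ℍᵐᵒᵖ X :=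
  (sqDomain A).subtype ∘ₗ DeltaInv A q h

/-- The `S`-resolvent set `ρ_S(A)`. -/
def resolventSet (A : X →ₗ.[ℍᵐᵒᵖ] X) : Set ℍ :=
  {q | ∃ h : Function.Bijective (Delta A q), Q A q h ∈ boundedOps X}

/-- The `S`-resolvent operator `S_q⁻¹(A) = Q_q(A) q̄ - A Q_q(A)`. -/
def SInv (A : X →ₗ.[ℍᵐᵒᵖ] X) (q : ℍ) (h : Function.Bijective (Delta A q)) :
    Module.End ℍᵐᵒᵖ X :=
  opMul (Q A q h) (star q) - A.toFun ∘ₗ sqIncl A ∘ₗ DeltaInv A q h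

/-- The operators `B_n`: `B_{2k} = Q_{q₀}(A)^k` and `B_{2k+1} = Q_{q₀}(A)^k S_{q₀}⁻¹(A)`. -/
def B (A : X →ₗ.[ℍᵐᵒᵖ] X) (q₀ : ℍ) (h : Function.Bijective (Delta A q₀)) (n : ℕ) :
    Module.End ℍᵐᵒᵖ X :=
  if Even n then Q A q₀ h ^ (n / 2) else Q A q₀ h ^ (n / 2) * SInv A q₀ h

end Operators

/-- The functions `P_{q₀,n}`: `P_{q₀,2k}(q) = △_{q₀}(q)^k`,
`P_{q₀,2k+1}(q) = (q - q₀) △_{q₀}(q)^k`. -/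
def P (q₀ : ℍ) (n : ℕ) (q : ℍ) : ℍ :=
  if Even n then tri q₀ q ^ (n / 2) else (q - q₀) * tri q₀ q ^ (n / 2)

end SRes

end

noncomputable section

namespace SRes

/-! ### Quaternionic identities for `△` -/

/-! Write `T_p` for the map `x ↦ A x - x p`, which is only real linear. Real coefficients commute
with everything, so `Δ_p(A) = T_p T_{p̄}` (`quadratic_eq`), and invertibility of `Δ_p(A)` reduces to
that of the two first-order factors. Similarly, `Δ_q(A) x - x △_q(p) = T_p (A x + x (p - 2 Re q))`.
Applied to `x = Q_q(A) w`, the left side is a perturbation of the identity, invertible by a Neumann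
series as soon as `‖Q_q(A)‖ |△_q(p)| < 1`. Hence `T_p` is onto with a bounded right inverse
(`exists_graph_sub_smul`), and an equation `A x = x p` forces `x = 0` (`eq_zero_of_graph_smul`). The
smallness condition describes exactly the Cassini ball and is invariant under `p ↦ p̄`, so (i)
follows, and (ii) from (i). For (iii), applying `Q_q(A) Δ_q(A) = Id` to `S_p⁻¹(A) x - S_q⁻¹(A) x`
gives a fixed-point identity (`SInv_eq`). Iterating it produces the partial sums with remainder
`Q_q(A)^N S_p⁻¹(A) △_q(p)^N`, which decays geometrically. -/

lemma toUpper_star (q : ℍ) : toUpper (star q) = toUpper q := by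
  simp [toUpper]

lemma norm_tri_star (q p : ℍ) : ‖tri q (star p)‖ = ‖tri q p‖ := by
  rw [norm_tri, norm_tri, toUpper_star]

lemma tri_eq (q p : ℍ) :
    tri q p = p * p - p * ((2 * q.re : ℝ) : ℍ) + ((‖q‖ ^ 2 : ℝ) : ℍ) := by
  rw [tri, sq, Quaternion.coe_commutes]

lemma tri_self (q : ℍ) : tri q q = 0 := by
  rw [← norm_eq_zero, norm_tri, sub_self, norm_zero, zero_mul]

lemma star_eq_two_re_sub (q : ℍ) : star q = ((2 * q.re : ℝ) : ℍ) - q := by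
  rw [eq_sub_iff_add_eq, Quaternion.star_add_self]
  push_cast
  rfl

/-! ### Bounded right linear operators -/

section Bounded

variable {X : Type*} [NormedAddCommGroup X] [Module ℍᵐᵒᵖ X]

lemma opNorm_le_of_bound {B : Module.End ℍᵐᵒᵖ X} {C : ℝ} (hC : 0 ≤ C)
    (h : ∀ x, ‖B x‖ ≤ C * ‖x‖) : opNorm B ≤ ENNReal.ofReal C :=
  iSup₂_le fun x hx => ENNReal.ofReal_le_ofReal ((h x).trans (mul_le_of_le_one_right hC hx))

lemma mem_boundedOps_of_bound {B : Module.End ℍᵐᵒᵖ X} {C : ℝ}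
    (h : ∀ x, ‖B x‖ ≤ C * ‖x‖) : B ∈ boundedOps X := by
  refine (opNorm_le_of_bound (le_max_right C 0) fun x => (h x).trans ?_).trans_lt
    ENNReal.ofReal_lt_top
  gcongr
  exact le_max_left _ _

lemma one_mem_boundedOps : (1 : Module.End ℍᵐᵒᵖ X) ∈ boundedOps X :=
  mem_boundedOps_of_bound (C := 1) fun x => by simp

lemma neg_one_pow_mul_apply (n : ℕ) (B : Module.End ℍᵐᵒᵖ X) (x : X) :
    ((-1) ^ n * B) x = B x ∨ ((-1) ^ n * B) x = -B x := by
  rcases neg_one_pow_eq_or (Module.End ℍᵐᵒᵖ X) n with h | h <;> simp [h]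

variable [Module ℍ X] [BanachTwoSidedModule X]

variable (X) in
/-- The real normed space underlying a Banach two-sided module. -/
abbrev realNormedSpace : NormedSpace ℝ X where
  toModule := Module.compHom X (algebraMap ℝ ℍ)
  norm_smul_le r x := by
    change ‖(algebraMap ℝ ℍ r) • x‖ ≤ _
    rw [BanachTwoSidedModule.norm_left_smul, norm_algebraMap']

attribute [local instance] realNormedSpace

lemma real_smul_eq (r : ℝ) (x : X) : r • x = op (r : ℍ) • x :=
  BanachTwoSidedModule.real_smul r x

/-- A right linear operator, regarded as a real linear one. -/
def toRealLin (B : Module.End ℍᵐᵒᵖ X) : X →ₗ[ℝ] X where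
  toFun := B
  map_add' := map_add B
  map_smul' r x := by simp only [real_smul_eq, map_smul, RingHom.id_apply]

@[simp] lemma toRealLin_apply (B : Module.End ℍᵐᵒᵖ X) (x : X) : toRealLin B x = B x := rfl

lemma norm_apply_le {B : Module.End ℍᵐᵒᵖ X} (hB : B ∈ boundedOps X) (x : X) :
    ‖B x‖ ≤ (opNorm B).toReal * ‖x‖ := by
  rcases eq_or_ne x 0 with rfl | hx
  · simp
  have hx' : 0 < ‖x‖ := norm_pos_iff.2 hx
  have h1 : ‖(‖x‖⁻¹ • x : X)‖ ≤ 1 := by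
    rw [norm_smul, norm_inv, norm_norm, inv_mul_cancel₀ hx'.ne']
  have h2 : ENNReal.ofReal ‖B (‖x‖⁻¹ • x)‖ ≤ opNorm B :=
    le_iSup₂ (f := fun (y : X) (_ : ‖y‖ ≤ 1) => ENNReal.ofReal ‖B y‖) _ h1
  have h3 := (ENNReal.ofReal_le_iff_le_toReal (ne_of_lt hB)).1 h2
  rw [← toRealLin_apply, map_smul, norm_smul, norm_inv, norm_norm, toRealLin_apply,
    inv_mul_le_iff₀ hx'] at h3
  rwa [mul_comm]

lemma mem_boundedOps_iff {B : Module.End ℍᵐᵒᵖ X} :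
    B ∈ boundedOps X ↔ ∃ C, ∀ x, ‖B x‖ ≤ C * ‖x‖ :=
  ⟨fun h => ⟨_, norm_apply_le h⟩, fun ⟨_, h⟩ => mem_boundedOps_of_bound h⟩

lemma leftMul_mem_boundedOps (q : ℍ) : (leftMul q : Module.End ℍᵐᵒᵖ X) ∈ boundedOps X :=
  mem_boundedOps_of_bound fun x => (BanachTwoSidedModule.norm_left_smul q x).le

lemma mul_mem_boundedOps {B C : Module.End ℍᵐᵒᵖ X} (hB : B ∈ boundedOps X)
    (hC : C ∈ boundedOps X) : B * C ∈ boundedOps X := by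
  refine mem_boundedOps_of_bound (C := (opNorm B).toReal * (opNorm C).toReal) fun x => ?_
  rw [mul_assoc]
  exact (norm_apply_le hB _).trans
    (mul_le_mul_of_nonneg_left (norm_apply_le hC x) ENNReal.toReal_nonneg)

lemma sub_mem_boundedOps {B C : Module.End ℍᵐᵒᵖ X} (hB : B ∈ boundedOps X)
    (hC : C ∈ boundedOps X) : B - C ∈ boundedOps X := by
  refine mem_boundedOps_of_bound (C := (opNorm B).toReal + (opNorm C).toReal) fun x => ?_
  rw [add_mul]
  exact (norm_sub_le _ _).trans (add_le_add (norm_apply_le hB x) (norm_apply_le hC x))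

lemma pow_mem_boundedOps {B : Module.End ℍᵐᵒᵖ X} (hB : B ∈ boundedOps X) (n : ℕ) :
    B ^ n ∈ boundedOps X := by
  induction n with
  | zero => exact one_mem_boundedOps
  | succ n ih => exact pow_succ B n ▸ mul_mem_boundedOps ih hB

lemma opMul_mem_boundedOps {B : Module.End ℍᵐᵒᵖ X} (hB : B ∈ boundedOps X) (q : ℍ) :
    opMul B q ∈ boundedOps X :=
  mul_mem_boundedOps hB (leftMul_mem_boundedOps q)

lemma neg_one_pow_mul_mem_boundedOps {B : Module.End ℍᵐᵒᵖ X} (hB : B ∈ boundedOps X) (n : ℕ) :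
    (-1) ^ n * B ∈ boundedOps X := by
  refine mem_boundedOps_of_bound fun x => le_trans (le_of_eq ?_) (norm_apply_le hB x)
  rcases neg_one_pow_mul_apply n B x with h | h <;> simp [h]

/-- Closed graph theorem for right linear operators. -/
lemma mem_boundedOps_of_isClosed_graph {B : Module.End ℍᵐᵒᵖ X}
    (h : ∀ (u : ℕ → X) (x y : X), Tendsto u atTop (𝓝 x) →
      Tendsto (fun n => B (u n)) atTop (𝓝 y) → y = B x) : B ∈ boundedOps X := by
  have hc : Continuous (toRealLin B) :=
    (toRealLin B).continuous_of_seq_closed_graph fun u x y hx hy => h u x y hx hy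
  exact mem_boundedOps_of_bound (ContinuousLinearMap.le_opNorm ⟨toRealLin B, hc⟩)

/-- Solvability of `w - B (w t) = z` when `‖B‖ |t| < 1`. -/
lemma exists_sub_apply_smul_eq {B : Module.End ℍᵐᵒᵖ X} {c : ℝ} {t : ℍ}
    (hB : ∀ x, ‖B x‖ ≤ c * ‖x‖) (hc : 0 ≤ c) (hct : c * ‖t‖ < 1) (z : X) :
    ∃ w, w - op t • B w = z ∧ ‖w‖ ≤ (1 - c * ‖t‖)⁻¹ * ‖z‖ := by
  have hb : ∀ w, ‖op t • B w‖ ≤ c * ‖t‖ * ‖w‖ := fun w => by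
    rw [BanachTwoSidedModule.norm_right_smul, mul_comm c, mul_assoc]
    gcongr
    exact hB w
  -- Right multiplication by `t` is not right linear; real linearity is enough for the Neumann
  -- series.
  let L : X →ₗ[ℝ] X :=
    { toFun := fun w => op t • B w
      map_add' := fun x y => by rw [map_add, smul_add]
      map_smul' := fun r x => by
        simp only [real_smul_eq, map_smul, RingHom.id_apply, smul_smul, ← op_mul]
        rw [Quaternion.coe_commutes] }
  let T : X →L[ℝ] X := L.mkContinuous (c * ‖t‖) hb
  have hT : ‖T‖ < 1 := (L.mkContinuous_norm_le (by positivity) hb).trans_lt hct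
  obtain ⟨u, hu⟩ := isUnit_one_sub_of_norm_lt_one hT
  have hw : (u⁻¹ : (X →L[ℝ] X)ˣ).1 z - op t • B ((u⁻¹ : (X →L[ℝ] X)ˣ).1 z) = z := by
    have := congrArg (fun F : X →L[ℝ] X => F z) u.mul_inv
    rw [hu] at this
    exact this
  refine ⟨_, hw, ?_⟩
  have h1 := norm_sub_norm_le ((u⁻¹ : (X →L[ℝ] X)ˣ).1 z) (op t • B ((u⁻¹ : (X →L[ℝ] X)ˣ).1 z))
  rw [hw] at h1
  rw [le_inv_mul_iff₀ (by linarith)]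
  nlinarith [hb ((u⁻¹ : (X →L[ℝ] X)ˣ).1 z)]

end Bounded

/-! ### `Δ_q(A)` and its inverse in terms of the graph of `A` -/

section Resolvent

variable {X : Type*} [NormedAddCommGroup X] [Module ℍᵐᵒᵖ X] {A : X →ₗ.[ℍᵐᵒᵖ] X}

lemma sqDomain_graph (x : sqDomain A) :
    ((x : X), A (sqIncl A x)) ∈ A.graph ∧ (A (sqIncl A x), sqOp A x) ∈ A.graph :=
  ⟨A.mem_graph (sqIncl A x), A.mem_graph ⟨A (sqIncl A x), map_sqIncl_mem A x⟩⟩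

lemma graph_smul (p : ℍ) {x y : X} (hxy : (x, y) ∈ A.graph) :
    (op p • x, op p • y) ∈ A.graph :=
  A.graph.smul_mem (op p) hxy

lemma graph_add {x y x' y' : X} (hxy : (x, y) ∈ A.graph) (hxy' : (x', y') ∈ A.graph) :
    (x + x', y + y') ∈ A.graph :=
  A.graph.add_mem hxy hxy'

lemma graph_sub {x y x' y' : X} (hxy : (x, y) ∈ A.graph) (hxy' : (x', y') ∈ A.graph) :
    (x - x', y - y') ∈ A.graph :=
  A.graph.sub_mem hxy hxy'

lemma real_smul_smul_comm (r : ℝ) (p : ℍ) (x : X) :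
    op (r : ℍ) • op p • x = op p • op (r : ℍ) • x := by
  rw [smul_smul, smul_smul, ← op_mul, ← op_mul, Quaternion.coe_commutes]

lemma op_tri_smul (q p : ℍ) (x : X) :
    op (tri q p) • x = op p • op p • x - op ((2 * q.re : ℝ) : ℍ) • op p • x
      + op ((‖q‖ ^ 2 : ℝ) : ℍ) • x := by
  rw [tri_eq, op_add, op_sub, op_mul, op_mul, add_smul, sub_smul, mul_smul, mul_smul]

/-- `A² - 2 Re(p) A + |p|²` is the composition of `x ↦ A x - x p̄` and `x ↦ A x - x p`. -/
lemma quadratic_eq (p : ℍ) (x y z : X) :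
    z - op ((2 * p.re : ℝ) : ℍ) • y + op ((‖p‖ ^ 2 : ℝ) : ℍ) • x =
      (z - op (star p) • y) - op p • (y - op (star p) • x) := by
  rw [smul_sub, smul_smul, ← op_mul, sq, ← Quaternion.normSq_eq_norm_mul_self,
    ← Quaternion.star_mul_self, star_eq_two_re_sub, op_sub, sub_smul]
  abel

variable [Module ℍ X] [BanachTwoSidedModule X]

lemma Delta_apply (q : ℍ) (x : sqDomain A) :
    Delta A q x = sqOp A x - op ((2 * q.re : ℝ) : ℍ) • A (sqIncl A x)
      + op ((‖q‖ ^ 2 : ℝ) : ℍ) • (x : X) := by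
  rw [← BanachTwoSidedModule.real_smul, ← BanachTwoSidedModule.real_smul]
  rfl

lemma exists_Delta_eq (q : ℍ) {x y z : X} (hxy : (x, y) ∈ A.graph) (hyz : (y, z) ∈ A.graph) :
    ∃ h : x ∈ sqDomain A, Delta A q ⟨x, h⟩ =
      z - op ((2 * q.re : ℝ) : ℍ) • y + op ((‖q‖ ^ 2 : ℝ) : ℍ) • x := by
  obtain ⟨a, rfl, rfl⟩ := LinearPMap.mem_graph_iff A |>.1 hxy
  have h : (a : X) ∈ sqDomain A := ⟨a, LinearPMap.mem_domain_of_mem_graph hyz, rfl⟩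
  refine ⟨h, ?_⟩
  rw [Delta_apply, A.mem_graph_snd_inj hyz (sqDomain_graph (⟨(a : X), h⟩ : sqDomain A)).2 rfl]
  rfl

/-- The operator `A Q_q(A)`. -/
def AQ (A : X →ₗ.[ℍᵐᵒᵖ] X) (q : ℍ) (h : Function.Bijective (Delta A q)) : Module.End ℍᵐᵒᵖ X :=
  A.toFun ∘ₗ sqIncl A ∘ₗ DeltaInv A q h

variable {q : ℍ} (h : Function.Bijective (Delta A q))

lemma SInv_apply (x : X) : SInv A q h x = Q A q h (star q • x) - AQ A q h x := rfl

lemma Delta_DeltaInv (x : X) : Delta A q (DeltaInv A q h x) = x :=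
  (LinearEquiv.ofBijective (Delta A q) h).apply_symm_apply x

lemma Q_graph (x : X) : (Q A q h x, AQ A q h x) ∈ A.graph :=
  (sqDomain_graph (DeltaInv A q h x)).1

/-- Solving `Δ_q(A) Q_q(A) x = x` for the second-order term gives the value of `A² Q_q(A) x`. -/
lemma AQ_graph (x : X) : (AQ A q h x, x + op ((2 * q.re : ℝ) : ℍ) • AQ A q h x
    - op ((‖q‖ ^ 2 : ℝ) : ℍ) • Q A q h x) ∈ A.graph := by
  have h1 : (AQ A q h x, sqOp A (DeltaInv A q h x)) ∈ A.graph :=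
    (sqDomain_graph (DeltaInv A q h x)).2
  have h2 : x = sqOp A (DeltaInv A q h x) - op ((2 * q.re : ℝ) : ℍ) • AQ A q h x
      + op ((‖q‖ ^ 2 : ℝ) : ℍ) • Q A q h x :=
    (Delta_DeltaInv h x).symm.trans (Delta_apply q _)
  convert h1 using 2
  rw [sub_eq_iff_eq_add, ← eq_sub_iff_add_eq]
  exact h2.trans (sub_add_eq_add_sub _ _ _)

/-- The identity `Q_q(A) Δ_q(A) x = x`, stated with `y = A x` and `z = A² x` read off the graph so
that no domain proofs are carried along. -/
lemma Q_eq_of_graph {x y z : X} (hxy : (x, y) ∈ A.graph) (hyz : (y, z) ∈ A.graph) :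
    Q A q h (z - op ((2 * q.re : ℝ) : ℍ) • y + op ((‖q‖ ^ 2 : ℝ) : ℍ) • x) = x := by
  obtain ⟨hx, e⟩ := exists_Delta_eq q hxy hyz
  rw [← e]
  exact congrArg Subtype.val
    ((LinearEquiv.ofBijective (Delta A q) h).symm_apply_apply ⟨x, hx⟩)

lemma Q_injective : Function.Injective (Q A q h) :=
  Subtype.val_injective.comp (LinearEquiv.ofBijective (Delta A q) h).symm.injective

/-- `Q_q(A)` is injective, hence nonzero on a nonzero space. This makes the Cassini radius positive.
-/
lemma opNorm_Q_pos [Nontrivial X] (hQ : Q A q h ∈ boundedOps X) :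
    0 < (opNorm (Q A q h)).toReal := by
  obtain ⟨x, hx⟩ := exists_ne (0 : X)
  by_contra hn
  have h0 : (opNorm (Q A q h)).toReal = 0 := le_antisymm (not_lt.1 hn) ENNReal.toReal_nonneg
  have h1 := norm_apply_le hQ x
  rw [h0, zero_mul, norm_le_zero_iff] at h1
  exact hx (Q_injective h (h1.trans (map_zero _).symm))

/-- Closed graph theorem: `A Q_q(A)` is everywhere defined, and it inherits a closed graph from `A`
because `Q_q(A)` is continuous. -/
lemma AQ_mem_boundedOps (hA : IsClosedOp A) (hQ : Q A q h ∈ boundedOps X) :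
    AQ A q h ∈ boundedOps X := by
  refine mem_boundedOps_of_isClosed_graph fun u x y hu hy => ?_
  have hQu : Tendsto (fun n => Q A q h (u n)) atTop (𝓝 (Q A q h x)) := by
    rw [tendsto_iff_norm_sub_tendsto_zero] at hu ⊢
    refine squeeze_zero (fun _ => norm_nonneg _) (fun n => ?_)
      (by simpa using hu.const_mul (opNorm (Q A q h)).toReal)
    rw [← map_sub]
    exact norm_apply_le hQ _
  have hmem : (Q A q h x, y) ∈ A.graph :=
    IsClosed.mem_of_tendsto hA (hQu.prodMk_nhds hy) (Eventually.of_forall fun n => Q_graph h (u n))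
  exact LinearPMap.mem_graph_snd_inj A hmem (Q_graph h x) rfl

lemma SInv_mem_boundedOps (hA : IsClosedOp A) (hQ : Q A q h ∈ boundedOps X) :
    SInv A q h ∈ boundedOps X :=
  sub_mem_boundedOps (opMul_mem_boundedOps hQ _) (AQ_mem_boundedOps h hA hQ)

lemma B_mem_boundedOps (hA : IsClosedOp A) (hQ : Q A q h ∈ boundedOps X) (n : ℕ) :
    B A q h n ∈ boundedOps X := by
  rw [B]
  split_ifs
  · exact pow_mem_boundedOps hQ _
  · exact mul_mem_boundedOps (pow_mem_boundedOps hQ _) (SInv_mem_boundedOps h hA hQ)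

/-! ### The operators `x ↦ A x - x p` -/

/-- `A` has no right eigenvalue `p` with `‖Q_q(A)‖ |△_q(p)| < 1`. -/
lemma eq_zero_of_graph_smul (hQ : Q A q h ∈ boundedOps X) {p : ℍ}
    (hp : (opNorm (Q A q h)).toReal * ‖tri q p‖ < 1) {x : X}
    (hx : (x, op p • x) ∈ A.graph) : x = 0 := by
  have e := Q_eq_of_graph h hx (graph_smul p hx)
  -- From `A x = x p` one gets `Δ_q(A) x = x △_q(p)`, so `x = Q_q(A)(x △_q(p))` has norm at most a
  -- factor below `1` times its own.
  rw [← op_tri_smul] at e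
  have h1 := norm_apply_le hQ (op (tri q p) • x)
  rw [e, BanachTwoSidedModule.norm_right_smul, ← mul_assoc] at h1
  by_contra hne
  nlinarith [norm_pos_iff.2 hne]

/-- `x ↦ A x - x p` is onto, with a bounded right inverse, when `‖Q_q(A)‖ |△_q(p)| < 1`. -/
lemma exists_graph_sub_smul (hA : IsClosedOp A) (hQ : Q A q h ∈ boundedOps X) {p : ℍ}
    (hp : (opNorm (Q A q h)).toReal * ‖tri q p‖ < 1) :
    ∃ C, ∀ z : X, ∃ y, (y, op p • y + z) ∈ A.graph ∧ ‖y‖ ≤ C * ‖z‖ := by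
  set c := (opNorm (Q A q h)).toReal with hc
  obtain ⟨d, hd⟩ := mem_boundedOps_iff.1 (AQ_mem_boundedOps h hA hQ)
  refine ⟨(|d| + ‖p - ((2 * q.re : ℝ) : ℍ)‖ * c) * (1 - c * ‖tri q p‖)⁻¹, fun z => ?_⟩
  obtain ⟨w, hw, hwz⟩ := exists_sub_apply_smul_eq (norm_apply_le hQ) ENNReal.toReal_nonneg hp z
  -- The factorization of `Δ_q(A) - △_q(p)` dictates `y = A v + v (p - 2 Re q)` with `v = Q_q(A) w`;
  -- then `A y - y p = w - v △_q(p) = z`.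
  refine ⟨AQ A q h w + op (p - ((2 * q.re : ℝ) : ℍ)) • Q A q h w, ?_, ?_⟩
  · convert graph_add (AQ_graph h w) (graph_smul (p - ((2 * q.re : ℝ) : ℍ)) (Q_graph h w)) using 2
    rw [← hw, op_tri_smul]
    simp only [op_sub, sub_smul, smul_add, smul_sub, real_smul_smul_comm]
    abel
  · rw [mul_assoc]
    have h1 : ‖AQ A q h w‖ ≤ |d| * ‖w‖ := (hd w).trans (by gcongr; exact le_abs_self d)
    have h2 : ‖op (p - ((2 * q.re : ℝ) : ℍ)) • Q A q h w‖ ≤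
        ‖p - ((2 * q.re : ℝ) : ℍ)‖ * c * ‖w‖ := by
      rw [BanachTwoSidedModule.norm_right_smul, mul_assoc]
      gcongr
      exact norm_apply_le hQ w
    have h3 : ‖AQ A q h w + op (p - ((2 * q.re : ℝ) : ℍ)) • Q A q h w‖ ≤
        (|d| + ‖p - ((2 * q.re : ℝ) : ℍ)‖ * c) * ‖w‖ := by
      rw [add_mul]
      exact (norm_add_le _ _).trans (add_le_add h1 h2)
    have hc0 : 0 ≤ c := ENNReal.toReal_nonneg
    exact h3.trans (by gcongr)

/-- The points `p` with `‖Q_q(A)‖ |△_q(p)| < 1` belong to the `S`-resolvent set. -/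
lemma mem_resolventSet_of_norm_tri_lt (hA : IsClosedOp A) (hQ : Q A q h ∈ boundedOps X) {p : ℍ}
    (hp : (opNorm (Q A q h)).toReal * ‖tri q p‖ < 1) : p ∈ resolventSet A := by
  have hp' : (opNorm (Q A q h)).toReal * ‖tri q (star p)‖ < 1 := by rwa [norm_tri_star]
  have inj : Function.Injective (Delta A p) := by
    refine (injective_iff_map_eq_zero _).2 fun x hx => ?_
    -- With `u = A x - x p̄`, the kernel equation says `A u = u p`, so `u = 0`; then `A x = x p̄`
    -- gives `x = 0`.
    obtain ⟨h1, h2⟩ := sqDomain_graph x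
    rw [Delta_apply, quadratic_eq, sub_eq_zero] at hx
    have h3 := graph_sub h2 (graph_smul (star p) h1)
    rw [hx] at h3
    have h4 := sub_eq_zero.1 (eq_zero_of_graph_smul h hQ hp h3)
    rw [h4] at h1
    exact Subtype.ext (eq_zero_of_graph_smul h hQ hp' h1)
  obtain ⟨C, hC⟩ := exists_graph_sub_smul h hA hQ hp
  obtain ⟨D, hD⟩ := exists_graph_sub_smul h hA hQ hp'
  have key : ∀ z : X, ∃ x : sqDomain A, Delta A p x = z ∧ ‖(x : X)‖ ≤ |D| * C * ‖z‖ := by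
    intro z
    -- Invert the factors in turn: `A y - y p = z`, then `A x - x p̄ = y`.
    obtain ⟨y, hy, hyz⟩ := hC z
    obtain ⟨x, hx, hxy⟩ := hD y
    obtain ⟨hm, e⟩ := exists_Delta_eq p hx (graph_add (graph_smul (star p) hx) hy)
    refine ⟨⟨x, hm⟩, ?_, ?_⟩
    · rw [e, quadratic_eq]
      abel_nf
    · refine hxy.trans ?_
      rw [mul_assoc]
      exact mul_le_mul (le_abs_self D) hyz (norm_nonneg _) (abs_nonneg _)
  have bij : Function.Bijective (Delta A p) :=
    ⟨inj, fun z => (key z).imp fun _ hx => hx.1⟩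
  refine ⟨bij, mem_boundedOps_of_bound (C := |D| * C) fun z => ?_⟩
  obtain ⟨x, hx, hxz⟩ := key z
  rwa [show Q A p bij z = x from congrArg Subtype.val (inj ((Delta_DeltaInv bij z).trans hx.symm))]

/-! ### The expansion of the `S`-resolvent -/

/-- The right `S`-resolvent equation `A S_q⁻¹(A) = S_q⁻¹(A) q - Id`. -/
lemma SInv_graph (x : X) : (SInv A q h x, SInv A q h (q • x) - x) ∈ A.graph := by
  have h1 := graph_sub (Q_graph h (star q • x)) (AQ_graph h x)
  have e : AQ A q h (star q • x) =
      op ((2 * q.re : ℝ) : ℍ) • AQ A q h x - AQ A q h (q • x) := by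
    rw [star_eq_two_re_sub, sub_smul, map_sub, BanachTwoSidedModule.real_smul, map_smul]
  rw [e, ← SInv_apply] at h1
  convert h1 using 2
  rw [SInv_apply, smul_smul, Quaternion.star_mul_self, Quaternion.normSq_eq_norm_mul_self, ← sq,
    BanachTwoSidedModule.real_smul, map_smul]
  abel

variable {p : ℍ} (hp : Function.Bijective (Delta A p))

/-- In `u = S_p⁻¹(A) x - S_q⁻¹(A) x` the `Id` terms of the resolvent equations cancel, so `A u` is
again in the domain. Since `△_q(q) = 0`, `Δ_q(A) u = S_p⁻¹(A) △_q(p) x - (p - q) x`; apply `Q_q(A)`.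
-/
lemma SInv_eq (x : X) : SInv A p hp x =
    SInv A q h x - Q A q h ((p - q) • x) + Q A q h (SInv A p hp (tri q p • x)) := by
  have h1 := graph_sub (SInv_graph hp x) (SInv_graph h x)
  have h2 := graph_sub (SInv_graph hp (p • x)) (SInv_graph h (q • x))
  have e1 : SInv A p hp (p • x) - x - (SInv A q h (q • x) - x) =
    SInv A p hp (p • x) - SInv A q h (q • x) := by abel
  rw [e1] at h1
  have h3 := Q_eq_of_graph h h1 h2
  have e2 : SInv A p hp (p • p • x) - p • x - (SInv A q h (q • q • x) - q • x)
      - op ((2 * q.re : ℝ) : ℍ) • (SInv A p hp (p • x) - SInv A q h (q • x))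
      + op ((‖q‖ ^ 2 : ℝ) : ℍ) • (SInv A p hp x - SInv A q h x) =
      SInv A p hp (tri q p • x) - SInv A q h (tri q q • x) - (p - q) • x := by
    simp only [smul_sub, ← map_smul, ← BanachTwoSidedModule.real_smul, tri, sq p, sq q, add_smul,
      sub_smul, mul_smul, map_add, map_sub]
    abel
  rw [e2, tri_self, zero_smul, map_zero, sub_zero, map_sub] at h3
  rw [eq_comm, ← sub_eq_zero] at h3
  rw [← sub_eq_zero, ← h3]
  abel

/-- The terms of the expansion of `S_p⁻¹(A)` around `q`. -/
abbrev seriesTerm (p : ℍ) (n : ℕ) : Module.End ℍᵐᵒᵖ X :=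
  (-1) ^ n * opMul (B A q h (n + 1)) (P q n p)

lemma seriesTerm_two_mul (k : ℕ) (x : X) :
    seriesTerm h p (2 * k) x = (Q A q h ^ k) (SInv A q h (tri q p ^ k • x)) := by
  have e : (2 * k + 1) / 2 = k := by omega
  simp [seriesTerm, opMul, B, P, leftMul, e]

lemma seriesTerm_two_mul_add_one (k : ℕ) (x : X) :
    seriesTerm h p (2 * k + 1) x =
      -(Q A q h ^ k) (Q A q h ((p - q) • tri q p ^ k • x)) := by
  have e : (2 * k + 1) / 2 = k := by omega
  have e' : (2 * k + 1 + 1) / 2 = k + 1 := by omega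
  have e'' : Even (2 * k + 1 + 1) := ⟨k + 1, by ring⟩
  simp [seriesTerm, opMul, B, P, leftMul, e, e', e'', pow_succ, mul_smul]

/-- Each use of `SInv_eq` on the remainder splits off one even and one odd term of the series. -/
lemma SInv_sub_sum_two_mul (N : ℕ) (x : X) :
    SInv A p hp x - (∑ n ∈ Finset.range (2 * N), seriesTerm h p n) x =
      (Q A q h ^ N) (SInv A p hp (tri q p ^ N • x)) := by
  induction N with
  | zero => simp
  | succ N ih =>
    rw [mul_add_one, Finset.sum_range_succ, Finset.sum_range_succ, LinearMap.add_apply,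
      LinearMap.add_apply, ← sub_sub, ← sub_sub, ih, SInv_eq h hp (tri q p ^ N • x),
      seriesTerm_two_mul, seriesTerm_two_mul_add_one, pow_succ (Q A q h), pow_succ' (tri q p),
      mul_smul, map_add, map_sub]
    simp only [Module.End.mul_apply]
    abel

lemma norm_pow_apply_le (hQ : Q A q h ∈ boundedOps X) {T : Module.End ℍᵐᵒᵖ X}
    (hT : T ∈ boundedOps X) (t : ℍ) (N : ℕ) (x : X) :
    ‖(Q A q h ^ N) (T (t ^ N • x))‖ ≤
      ((opNorm (Q A q h)).toReal * ‖t‖) ^ N * (opNorm T).toReal * ‖x‖ := by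
  have h1 : ∀ y, ‖(Q A q h ^ N) y‖ ≤ (opNorm (Q A q h)).toReal ^ N * ‖y‖ := by
    induction N with
    | zero => simp
    | succ N ih =>
      intro y
      rw [pow_succ', pow_succ', mul_assoc]
      exact (norm_apply_le hQ _).trans (mul_le_mul_of_nonneg_left (ih y) ENNReal.toReal_nonneg)
  refine (h1 _).trans ?_
  calc _ ≤ (opNorm (Q A q h)).toReal ^ N * ((opNorm T).toReal * ‖t ^ N • x‖) := by
        gcongr
        exact norm_apply_le hT _
    _ = _ := by
        rw [BanachTwoSidedModule.norm_left_smul, norm_pow, mul_pow]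
        ring

lemma seriesConvergesTo_SInv (hA : IsClosedOp A) (hQ : Q A q h ∈ boundedOps X)
    (hQp : Q A p hp ∈ boundedOps X) (hlt : (opNorm (Q A q h)).toReal * ‖tri q p‖ < 1) :
    SeriesConvergesTo (seriesTerm h p) (SInv A p hp) := by
  have hS := SInv_mem_boundedOps h hA hQ
  have hSp := SInv_mem_boundedOps hp hA hQp
  refine ⟨fun n => neg_one_pow_mul_mem_boundedOps
    (opMul_mem_boundedOps (B_mem_boundedOps h hA hQ _) _) n, hSp, ?_⟩
  set r := (opNorm (Q A q h)).toReal * ‖tri q p‖ with hr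
  have hr0 : 0 ≤ r := mul_nonneg ENNReal.toReal_nonneg (norm_nonneg _)
  -- The first summand bounds the remainder after an even number of terms; the second pays for the
  -- unpaired last term of an odd partial sum.
  set C := (opNorm (SInv A p hp)).toReal + (opNorm (SInv A q h)).toReal with hC
  have hC0 : 0 ≤ C := add_nonneg ENNReal.toReal_nonneg ENNReal.toReal_nonneg
  have hle : ∀ n, opNorm (∑ i ∈ Finset.range n, seriesTerm h p i - SInv A p hp) ≤
      ENNReal.ofReal (r ^ (n / 2) * C) := by
    intro n
    refine opNorm_le_of_bound (by positivity) fun x => ?_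
    have hx := norm_pow_apply_le h hQ hSp (tri q p) (n / 2) x
    have hx' := norm_pow_apply_le h hQ hS (tri q p) (n / 2) x
    have hs := SInv_sub_sum_two_mul h hp (n / 2) x
    rw [LinearMap.sub_apply, norm_sub_rev, hC, mul_add, add_mul]
    rcases Nat.even_or_odd' n with ⟨k, rfl | rfl⟩
    · have e : 2 * k / 2 = k := by omega
      rw [e] at hx hs ⊢
      rw [hs]
      exact hx.trans (le_add_of_nonneg_right (by positivity))
    · have e : (2 * k + 1) / 2 = k := by omega
      rw [e] at hx hx' hs ⊢
      rw [Finset.sum_range_succ, LinearMap.add_apply, ← sub_sub, hs, seriesTerm_two_mul]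
      exact (norm_sub_le _ _).trans (add_le_add hx hx')
  refine tendsto_of_tendsto_of_tendsto_of_le_of_le tendsto_const_nhds ?_ (fun _ => zero_le) hle
  have ht : Tendsto (fun n : ℕ => r ^ (n / 2) * C) atTop (𝓝 0) := by
    simpa using ((tendsto_pow_atTop_nhds_zero_of_lt_one hr0 hlt).comp
      (Nat.tendsto_div_const_atTop two_ne_zero)).mul_const C
  simpa using ENNReal.tendsto_ofReal ht

/-! ### Cassini balls -/

lemma mem_cassiniBall_iff {c : ℝ} (hc : 0 < c) :
    p ∈ cassiniBall q (c ^ (-(1 / 2) : ℝ)) ↔ c * ‖tri q p‖ < 1 := by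
  rw [Real.rpow_neg hc.le, ← Real.sqrt_eq_rpow, ← Real.sqrt_inv]
  change √_ < _ ↔ _
  rw [Real.sqrt_lt_sqrt_iff (norm_nonneg _), ← one_div, lt_div_iff₀' hc]

lemma isOpen_cassiniBall (q : ℍ) (R : ℝ) : IsOpen (cassiniBall q R) := by
  refine isOpen_lt ?_ continuous_const
  unfold cassiniDist tri
  fun_prop

lemma cassiniBall_subset_resolventSet [Nontrivial X] (hA : IsClosedOp A)
    (hq : q ∈ resolventSet A) :
    cassiniBall q ((opNorm (Q A q hq.fst)).toReal ^ (-(1 / 2) : ℝ)) ⊆ resolventSet A :=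
  fun _ hp => mem_resolventSet_of_norm_tri_lt hq.fst hA hq.snd
    ((mem_cassiniBall_iff (opNorm_Q_pos hq.fst hq.snd)).1 hp)

end Resolvent

end SRes

end

theorem theoremT {X : Type*} [NormedAddCommGroup X] [Module ℍ X] [Module ℍᵐᵒᵖ X]
    [BanachTwoSidedModule X] [Nontrivial X]
    (A : X →ₗ.[ℍᵐᵒᵖ] X) (hA : SRes.IsClosedOp A)
    (hreal : (SRes.resolventSet A ∩ Set.range ((↑) : ℝ → ℍ)).Nonempty)
    (q₀ : ℍ) (hq₀ : q₀ ∈ SRes.resolventSet A)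
    (R : ℝ) (hR : R = (SRes.opNorm (SRes.Q A q₀ hq₀.fst)).toReal ^ (-(1 / 2) : ℝ)) :
    0 < R ∧ (∀ n, SRes.B A q₀ hq₀.fst n ∈ SRes.boundedOps X) ∧
    -- (i)
    SRes.cassiniBall q₀ R ⊆ SRes.resolventSet A ∧
    -- (ii)
    IsOpen[SRes.cassiniTopology] (SRes.resolventSet A) ∧ IsOpen (SRes.resolventSet A) ∧
    -- (iii)
    ∀ q ∈ SRes.cassiniBall q₀ R, ∃ hq : q ∈ SRes.resolventSet A,
      SRes.SeriesConvergesTo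
        (fun n => (-1) ^ n * SRes.opMul (SRes.B A q₀ hq₀.fst (n + 1)) (SRes.P q₀ n q))
        (SRes.SInv A q hq.fst) := by
  have hpos : ∀ q (hq : q ∈ SRes.resolventSet A),
      0 < (SRes.opNorm (SRes.Q A q hq.fst)).toReal ^ (-(1 / 2) : ℝ) := fun q hq =>
    Real.rpow_pos_of_pos (SRes.opNorm_Q_pos hq.fst hq.snd) _
  have hball : ∀ q (hq : q ∈ SRes.resolventSet A), SRes.cassiniBall q
      ((SRes.opNorm (SRes.Q A q hq.fst)).toReal ^ (-(1 / 2) : ℝ)) ⊆ SRes.resolventSet A :=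
    fun q hq => SRes.cassiniBall_subset_resolventSet hA hq
  subst hR
  refine ⟨hpos q₀ hq₀, SRes.B_mem_boundedOps hq₀.fst hA hq₀.snd, hball q₀ hq₀, ?_, ?_, ?_⟩
  · exact (@Metric.isOpen_iff ℍ SRes.cassiniPseudoMetric _).2 fun q hq =>
      ⟨_, hpos q hq, hball q hq⟩
  -- Cassini balls are Euclidean open because `u` is continuous.
  · refine isOpen_iff_mem_nhds.2 fun q hq => mem_of_superset
      ((SRes.isOpen_cassiniBall q _).mem_nhds ?_) (hball q hq)
    change SRes.cassiniDist q q < _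
    rw [SRes.cassiniDist_self]
    exact hpos q hq
  · intro q hq
    have hq' := hball q₀ hq₀ hq
    exact ⟨hq', SRes.seriesConvergesTo_SInv hq₀.fst hq'.fst hA hq₀.snd hq'.snd
      ((SRes.mem_cassiniBall_iff (SRes.opNorm_Q_pos hq₀.fst hq₀.snd)).1 hq)⟩
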